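/- Let $m$ be Lebesgue measure on $(0,\infty)$. For a measurable, a.e. finite $x:(0,\infty)\to\mathbb R$ let $x^*(t)=\inf\{\tau\ge 0: m\{s>0:|x(s)|>\tau\}\le t\}$, $t>0$ (with $\inf\emptyset=\infty$). A rearrangement invariant (r.i.) space on $(0,\infty)$ is a real Banach space $X$ of (classes of) measurable a.e. finite functions on $(0,\infty)$ such that (1) if $y\in X$, $x$ is measurable and $|x|\le|y|$ a.e., then $x\in X$ and $\|x\|_X\le\|y\|_X$; and (2) if $y\in X$, $x$ is measurable and a.e. finite, and $x^*(t)\le y^*(t)$ for all $t>0$, then $x\in X$ and $\|x\|_X\le\|y\|_X$. Let $\sigma$ be the (bounded) doubling operator $\sigma x(t)=x(t/2)$ on $X$. A number $\lambda\in\mathbb R$ is an approximate eigenvalue of $\sigma$ if there are $u_n\in X$ with $\|u_n\|_X=1$ and $\|\sigma u_n-\lambda u_n\|_X\to0$. Let $\varphi_X(t)=\|\chi_A\|_X$, where $m(A)=t$, be the fundamental function of $X\neq\{0\}$. For a positive function $\psi$ on $(0,\infty)$ put $$M_\psi(t)=\sup_{s>0}\frac{\psi(ts)}{\psi(s)},\qquad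 M^0_\psi(t)=\sup_{0<s\le\min(1,1/t)}\frac{\psi(ts)}{\psi(s)},\qquad M^\infty_\psi(t)=\sup_{s\ge\max(1,1/t)}\frac{\psi(ts)}{\psi(s)},$$ and, for $\psi=\varphi_X$ (in which case these suprema are finite and the following limits exist), $$\mu_\psi=-\lim_{n\to\infty}\tfrac1n\log_2M_\psi(2^{-n}),\quad \nu_\psi=\lim_{n\to\infty}\tfrac1n\log_2M_\psi(2^n),\quad \nu^0_\psi=\lim_{n\to\infty}\tfrac1n\log_2M^0_\psi(2^n),\quad \mu^\infty_\psi=-\lim_{n\to\infty}\tfrac1n\log_2M^\infty_\psi(2^{-n}).$$ **Theorem.** Let $X\ne\{0\}$ be a separable r.i. space on $(0,\infty)$. (i) If $\mu^\infty_{\varphi_X}\le\nu^0_{\varphi_X}$, then every point of $[2^{\mu_{\varphi_X}},2^{\nu_{\varphi_X}}]$ is an approximate eigenvalue of $\sigma$ in $X$. (ii) If $\mu^\infty_{\varphi_X}>\nu^0_{\varphi_X}$, then every point of $[2^{\mu_{\varphi_X}},2^{\nu^0_{\varphi_X}}]\cup[2^{\mu^\infty_{\varphi_X}},2^{\nu_{\varphi_X}}]$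 is an approximate eigenvalue of $\sigma$ in $X$. -/

import Mathlib

open MeasureTheory Set Filter Topology
open scoped ENNReal

noncomputable section

/-- Lebesgue measure on the half-line `(0, ∞)`. -/
abbrev halfLine : Measure ℝ := volume.restrict (Ioi 0)

/-- Classes modulo a.e. equality of measurable, a.e. finite real functions on `(0, ∞)`. -/
abbrev HalfLineFun : Type := ℝ →ₘ[halfLine] ℝ

/-- The distribution function `τ ↦ m {s > 0 : |x s| > τ}`. -/
def distribution (x : HalfLineFun) (τ : ℝ≥0∞) : ℝ≥0∞ :=
  halfLine {s | τ < ‖x s‖ₑ}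

/-- The decreasing rearrangement `x* t = inf {τ ≥ 0 : m {s > 0 : |x s| > τ} ≤ t}`.
It takes values in `[0, ∞]`; the value `∞` is taken when no finite `τ` qualifies. -/
def rearrangement (x : HalfLineFun) (t : ℝ) : ℝ≥0∞ :=
  sInf {τ : ℝ≥0∞ | distribution x τ ≤ ENNReal.ofReal t}

/-- A linear space of functions on `(0, ∞)` together with a norm on it. -/
structure FunctionSpace where
  /-- the functions that belong to the space -/
  carrier : Submodule ℝ HalfLineFun
  /-- the norm -/
  nrm : AddGroupNorm carrier
  nrm_smul : ∀ (c : ℝ) (x : carrier), nrm (c • x) = |c| * nrm x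

instance FunctionSpace.instNormedAddCommGroup (X : FunctionSpace) :
    NormedAddCommGroup X.carrier :=
  X.nrm.toNormedAddCommGroup

instance FunctionSpace.instNormedSpace (X : FunctionSpace) : NormedSpace ℝ X.carrier where
  norm_smul_le c x := (X.nrm_smul c x).le

/-- The normed function space `X` is a rearrangement invariant Banach function lattice. -/
structure FunctionSpace.IsRearrangementInvariant (X : FunctionSpace) : Prop where
  /-- the space is complete -/
  complete : CompleteSpace X.carrier
  /-- the space is a function lattice -/
  ideal : ∀ (x : HalfLineFun) (y : X.carrier), (∀ᵐ s ∂halfLine, |x s| ≤ |y.1 s|) →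
    ∃ h : x ∈ X.carrier, ‖(⟨x, h⟩ : X.carrier)‖ ≤ ‖y‖
  /-- the space is rearrangement invariant -/
  rearr : ∀ (x : HalfLineFun) (y : X.carrier),
    (∀ t : ℝ, 0 < t → rearrangement x t ≤ rearrangement y.1 t) →
      ∃ h : x ∈ X.carrier, ‖(⟨x, h⟩ : X.carrier)‖ ≤ ‖y‖

/-- A rearrangement invariant Banach function space on `(0, ∞)`. -/
structure RISpace extends FunctionSpace where
  isRearrangementInvariant : toFunctionSpace.IsRearrangementInvariant

lemma RISpace.of_distribution_le (X : RISpace) (x : HalfLineFun) (y : X.carrier)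
    (h : ∀ τ, distribution x τ ≤ distribution y.1 τ) :
    ∃ h : x ∈ X.carrier, ‖(⟨x, h⟩ : X.carrier)‖ ≤ ‖y‖ :=
  X.isRearrangementInvariant.rearr x y fun _ _ => sInf_le_sInf fun τ hτ => (h τ).trans hτ

lemma distribution_congr {x : HalfLineFun} {f : ℝ → ℝ} (h : x =ᵐ[halfLine] f) (τ : ℝ≥0∞) :
    distribution x τ = halfLine {s | τ < ‖f s‖ₑ} := by
  refine measure_congr ?_
  filter_upwards [h] with s hs
  change (τ < ‖x s‖ₑ) = (τ < ‖f s‖ₑ)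
  rw [hs]

/-! ### The doubling operator -/

lemma quasiMeasurePreserving_half :
    Measure.QuasiMeasurePreserving (fun t : ℝ => t / 2) halfLine halfLine := by
  refine ⟨by fun_prop, Measure.AbsolutelyContinuous.mk fun s hs h => ?_⟩
  rw [Measure.map_apply (by fun_prop) hs, Measure.restrict_apply (by measurability)]
  rw [Measure.restrict_apply hs] at h
  have : (fun t : ℝ => t / 2) ⁻¹' s ∩ Ioi 0 = (fun t : ℝ => t * (2⁻¹ : ℝ)) ⁻¹' (s ∩ Ioi 0) := by
    ext t; simp [div_eq_mul_inv]
  rw [this, Real.volume_preimage_mul_right (by norm_num), h, mul_zero]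

/-- The function `t ↦ x (t / 2)`. -/
def dilateTwo (x : HalfLineFun) : HalfLineFun :=
  x.compQuasiMeasurePreserving (fun t => t / 2) quasiMeasurePreserving_half

lemma coeFn_dilateTwo (x : HalfLineFun) :
    dilateTwo x =ᵐ[halfLine] fun t => x (t / 2) :=
  AEEqFun.coeFn_compQuasiMeasurePreserving x quasiMeasurePreserving_half

lemma dilateTwo_add (x y : HalfLineFun) :
    dilateTwo (x + y) = dilateTwo x + dilateTwo y := by
  ext
  filter_upwards [coeFn_dilateTwo (x + y), coeFn_dilateTwo x, coeFn_dilateTwo y,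
    AEEqFun.coeFn_add (dilateTwo x) (dilateTwo y),
    quasiMeasurePreserving_half.ae (AEEqFun.coeFn_add x y)] with t h1 h2 h3 h4 h5
  rw [h1, h4, Pi.add_apply, h2, h3, h5, Pi.add_apply]

lemma dilateTwo_smul (c : ℝ) (x : HalfLineFun) :
    dilateTwo (c • x) = c • dilateTwo x := by
  ext
  filter_upwards [coeFn_dilateTwo (c • x), coeFn_dilateTwo x,
    AEEqFun.coeFn_smul c (dilateTwo x),
    quasiMeasurePreserving_half.ae (AEEqFun.coeFn_smul c x)] with t h1 h2 h3 h4
  rw [h1, h3, Pi.smul_apply, h2, h4, Pi.smul_apply]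

/-- The half-open unit intervals whose left end point is congruent to `e` modulo `2`. -/
def stripes (e : ℤ) : Set ℝ := ⋃ k : ℤ, Ico (2 * k + e : ℝ) (2 * k + e + 1)

/-- On `stripes e`, this translates `[2k + e, 2k + e + 1)` to `[k, k + 1)`. -/
def unstripe (e : ℤ) (t : ℝ) : ℝ := t - ⌊(t - e) / 2⌋ - e

lemma measurable_unstripe (e : ℤ) : Measurable (unstripe e) := by
  unfold unstripe
  exact (measurable_id.sub ((measurable_from_top (f := fun z : ℤ => (z : ℝ))).comp
    (Int.measurable_floor.comp (by fun_prop)))).sub_const _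

lemma unstripe_eq {e k : ℤ} {t : ℝ} (h : t ∈ Ico (2 * k + e : ℝ) (2 * k + e + 1)) :
    unstripe e t = t - (k + e) := by
  have : ⌊(t - e) / 2⌋ = k := by
    rw [Int.floor_eq_iff]
    constructor <;> linarith [h.1, h.2]
  rw [unstripe, this]; ring

lemma measurableSet_stripes (e : ℤ) : MeasurableSet (stripes e) :=
  MeasurableSet.iUnion fun _ => measurableSet_Ico

lemma volume_stripes_inter (e : ℤ) {S : Set ℝ} (hS : MeasurableSet S) :
    volume (stripes e ∩ unstripe e ⁻¹' S) = volume S := by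
  have h1 : stripes e ∩ unstripe e ⁻¹' S =
      ⋃ k : ℤ, (fun t : ℝ => t - (k + e)) ⁻¹' (S ∩ Ico (k : ℝ) (k + 1)) := by
    ext t
    simp only [stripes, mem_inter_iff, mem_iUnion, mem_preimage]
    constructor
    · rintro ⟨⟨k, hk⟩, hS⟩
      rw [unstripe_eq hk] at hS
      exact ⟨k, hS, by linarith [hk.1], by linarith [hk.2]⟩
    · rintro ⟨k, hS, hk⟩
      have hk' : t ∈ Ico (2 * k + e : ℝ) (2 * k + e + 1) :=
        ⟨by linarith [hk.1], by linarith [hk.2]⟩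
      exact ⟨⟨k, hk'⟩, by rwa [unstripe_eq hk']⟩
  have h2 : S = ⋃ k : ℤ, (S ∩ Ico (k : ℝ) (k + 1)) := by
    rw [← inter_iUnion, iUnion_Ico_intCast, inter_univ]
  have hd : Pairwise (Function.onFun Disjoint fun k : ℤ => S ∩ Ico (k : ℝ) (k + 1)) :=
    fun i j hij => (pairwise_disjoint_Ico_intCast ℝ hij).mono inter_subset_right inter_subset_right
  have hm : ∀ k : ℤ, MeasurableSet (S ∩ Ico (k : ℝ) (k + 1)) := fun k => hS.inter measurableSet_Ico
  conv_rhs => rw [h2, measure_iUnion hd hm]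
  rw [h1, measure_iUnion]
  · exact tsum_congr fun k => by
      simpa only [sub_eq_add_neg] using measure_preimage_add_right volume (-(k + e : ℝ)) _
  · intro i j hij
    refine disjoint_left.2 ?_
    rintro t ⟨-, hi⟩ ⟨-, hj⟩
    apply hij
    have a1 := hi.1
    have a2 := hi.2
    have b1 := hj.1
    have b2 := hj.2
    simp only at a1 a2 b1 b2
    have c1 : (2 * i : ℝ) < 2 * j + 1 := by linarith
    have c2 : (2 * j : ℝ) < 2 * i + 1 := by linarith
    have d1 : 2 * i < 2 * j + 1 := by exact_mod_cast c1
    have d2 : 2 * j < 2 * i + 1 := by exact_mod_cast c2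
    omega
  · exact fun k => (measurable_id.sub_const _) (hm k)

lemma unstripe_nonneg_iff {e : ℤ} (he : e = 0 ∨ e = 1) {t : ℝ} (ht : t ∈ stripes e) :
    0 ≤ unstripe e t ↔ 0 ≤ t := by
  obtain ⟨k, hk⟩ := mem_iUnion.1 ht
  rw [unstripe_eq hk]
  obtain ⟨a, b⟩ := hk
  constructor
  · intro h
    have : (-1 : ℝ) < k := by linarith
    have h0 : (0 : ℤ) ≤ k := by
      have : (-1 : ℤ) < k := by exact_mod_cast this
      omega
    have h0' : (0 : ℝ) ≤ k := by exact_mod_cast h0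
    rcases he with rfl | rfl <;> push_cast at * <;> linarith
  · intro h
    have h1 : (0 : ℝ) < 2 * k + e + 1 := by linarith
    have h0 : (0 : ℤ) ≤ k := by
      have : (0 : ℤ) < 2 * k + e + 1 := by exact_mod_cast h1
      omega
    have h0' : (0 : ℝ) ≤ k := by exact_mod_cast h0
    linarith

lemma halfLine_apply {S : Set ℝ} (hS : MeasurableSet S) : halfLine S = volume (S ∩ Ici 0) := by
  rw [halfLine, Measure.restrict_congr_set Ioi_ae_eq_Ici, Measure.restrict_apply hS]

/-- A copy of `x`, equimeasurable with `x` and supported by `stripes e`. -/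
def stripeCopy (e : ℤ) (x : HalfLineFun) : HalfLineFun :=
  AEEqFun.mk ((stripes e).indicator fun t => x (unstripe e t))
    ((x.measurable.comp (measurable_unstripe e)).indicator
      (measurableSet_stripes e)).aestronglyMeasurable

lemma measurableSet_superlevel (x : HalfLineFun) (τ : ℝ≥0∞) :
    MeasurableSet {s | τ < ‖x s‖ₑ} :=
  measurableSet_lt measurable_const x.measurable.enorm

lemma halfLine_stripes {e : ℤ} (he : e = 0 ∨ e = 1) (x : HalfLineFun) (τ : ℝ≥0∞) :
    halfLine (stripes e ∩ {t | τ < ‖x (unstripe e t)‖ₑ}) = distribution x τ := by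
  have hS := measurableSet_superlevel x τ
  have hT : MeasurableSet (stripes e ∩ {t | τ < ‖x (unstripe e t)‖ₑ}) :=
    (measurableSet_stripes e).inter (measurable_unstripe e hS)
  rw [distribution, halfLine_apply hS, halfLine_apply hT,
    ← volume_stripes_inter e (hS.inter measurableSet_Ici)]
  congr 1
  ext t
  constructor
  · rintro ⟨⟨h1, h2⟩, h3⟩
    exact ⟨h1, h2, (unstripe_nonneg_iff he h1).2 h3⟩
  · rintro ⟨h1, h2, h3⟩
    exact ⟨⟨h1, h2⟩, (unstripe_nonneg_iff he h1).1 h3⟩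

lemma superlevel_indicator (B : Set ℝ) (f : ℝ → ℝ) (τ : ℝ≥0∞) :
    {s | τ < ‖B.indicator f s‖ₑ} = B ∩ {s | τ < ‖f s‖ₑ} := by
  ext t
  by_cases h : t ∈ B <;> simp [h]

lemma distribution_stripeCopy {e : ℤ} (he : e = 0 ∨ e = 1) (x : HalfLineFun) (τ : ℝ≥0∞) :
    distribution (stripeCopy e x) τ = distribution x τ := by
  rw [stripeCopy, distribution_congr (AEEqFun.coeFn_mk _ _), superlevel_indicator,
    halfLine_stripes he]

lemma disjoint_stripes : Disjoint (stripes 0) (stripes 1) := by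
  refine disjoint_left.2 fun t h0 h1 => ?_
  obtain ⟨k, a, b⟩ := mem_iUnion.1 h0
  obtain ⟨j, c, d⟩ := mem_iUnion.1 h1
  push_cast at *
  have h1 : (2 * k : ℝ) < 2 * j + 1 + 1 := by linarith
  have h2 : (2 * j + 1 : ℝ) < 2 * k + 1 := by linarith
  have h1' : 2 * k < 2 * j + 1 + 1 := by exact_mod_cast h1
  have h2' : 2 * j + 1 < 2 * k + 1 := by exact_mod_cast h2
  omega

lemma distribution_dilateTwo (x : HalfLineFun) (τ : ℝ≥0∞) :
    distribution (dilateTwo x) τ = distribution (stripeCopy 0 x + stripeCopy 1 x) τ := by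
  have hS := measurableSet_superlevel x τ
  have hL : distribution (dilateTwo x) τ = 2 * distribution x τ := by
    have hT : MeasurableSet {s : ℝ | τ < ‖x (s / 2)‖ₑ} :=
      (by fun_prop : Measurable fun t : ℝ => t / 2) hS
    rw [distribution_congr (coeFn_dilateTwo x), distribution, Measure.restrict_apply hS,
      Measure.restrict_apply hT]
    have : {s : ℝ | τ < ‖x (s / 2)‖ₑ} ∩ Ioi 0 =
        (fun t : ℝ => t * (2⁻¹ : ℝ)) ⁻¹' ({s | τ < ‖x s‖ₑ} ∩ Ioi 0) := by
      ext t; simp [div_eq_mul_inv]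
    rw [this, Real.volume_preimage_mul_right (by norm_num)]
    simp
  have hR : (stripeCopy 0 x + stripeCopy 1 x : HalfLineFun) =ᵐ[halfLine] fun t =>
      (stripes 0).indicator (fun t => x (unstripe 0 t)) t +
        (stripes 1).indicator (fun t => x (unstripe 1 t)) t := by
    have h0 : stripeCopy 0 x =ᵐ[halfLine] _ := AEEqFun.coeFn_mk _ _
    have h1 : stripeCopy 1 x =ᵐ[halfLine] _ := AEEqFun.coeFn_mk _ _
    filter_upwards [AEEqFun.coeFn_add (stripeCopy 0 x) (stripeCopy 1 x), h0, h1] with t h h0 h1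
    rw [h, Pi.add_apply, h0, h1]
  rw [hL, distribution_congr hR]
  have hU : {s : ℝ | τ < ‖(stripes 0).indicator (fun t => x (unstripe 0 t)) s +
        (stripes 1).indicator (fun t => x (unstripe 1 t)) s‖ₑ} =
      (stripes 0 ∩ {t | τ < ‖x (unstripe 0 t)‖ₑ}) ∪
        (stripes 1 ∩ {t | τ < ‖x (unstripe 1 t)‖ₑ}) := by
    ext t
    by_cases h0 : t ∈ stripes 0
    · have h1 : t ∉ stripes 1 := disjoint_left.1 disjoint_stripes h0
      simp [h0, h1]
    · by_cases h1 : t ∈ stripes 1 <;> simp [h0, h1]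
  have hT : MeasurableSet (stripes 1 ∩ {t | τ < ‖x (unstripe 1 t)‖ₑ}) :=
    (measurableSet_stripes 1).inter (measurable_unstripe 1 hS)
  rw [hU, measure_union (disjoint_stripes.mono inter_subset_left inter_subset_left) hT,
    halfLine_stripes (Or.inl rfl), halfLine_stripes (Or.inr rfl), two_mul]

lemma RISpace.dilateTwo_mem (X : RISpace) (x : X.carrier) :
    ∃ h : dilateTwo x.1 ∈ X.carrier, ‖(⟨dilateTwo x.1, h⟩ : X.carrier)‖ ≤ 2 * ‖x‖ := by
  obtain ⟨h0, n0⟩ := X.of_distribution_le (stripeCopy 0 x.1) x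
    fun τ => (distribution_stripeCopy (Or.inl rfl) x.1 τ).le
  obtain ⟨h1, n1⟩ := X.of_distribution_le (stripeCopy 1 x.1) x
    fun τ => (distribution_stripeCopy (Or.inr rfl) x.1 τ).le
  obtain ⟨h, n⟩ := X.of_distribution_le (dilateTwo x.1)
    ((⟨stripeCopy 0 x.1, h0⟩ : X.carrier) + ⟨stripeCopy 1 x.1, h1⟩) fun τ => by
      rw [Submodule.coe_add]
      exact (distribution_dilateTwo x.1 τ).le
  refine ⟨h, n.trans ((norm_add_le _ _).trans ?_)⟩
  linarith

/-- The doubling operator `σ x (t) = x (t / 2)` as a bounded linear operator on `X`. -/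
def RISpace.doubling (X : RISpace) : X.carrier →L[ℝ] X.carrier :=
  LinearMap.mkContinuous
    { toFun := fun x => ⟨dilateTwo x.1, (X.dilateTwo_mem x).1⟩
      map_add' := fun x y => Subtype.ext (dilateTwo_add x.1 y.1)
      map_smul' := fun c x => Subtype.ext (dilateTwo_smul c x.1) }
    2 fun x => (X.dilateTwo_mem x).2

/-- `ev` is an approximate eigenvalue of `T`. -/
def IsApproximateEigenvalue {E : Type*} [NormedAddCommGroup E] [NormedSpace ℝ E]
    (T : E →L[ℝ] E) (ev : ℝ) : Prop :=
  ∃ u : ℕ → E, (∀ n, ‖u n‖ = 1) ∧ Tendsto (fun n => ‖T (u n) - ev • u n‖) atTop (𝓝 0)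

/-! ### The fundamental function -/

/-- The class of the characteristic function of `(a, b)`, where `0 ≤ a`. -/
def charInterval (a b : ℝ) : HalfLineFun :=
  AEEqFun.mk ((Ioo a b).indicator fun _ => (1 : ℝ))
    (measurable_const.indicator measurableSet_Ioo).aestronglyMeasurable

lemma coeFn_charInterval (a b : ℝ) :
    charInterval a b =ᵐ[halfLine] (Ioo a b).indicator fun _ => (1 : ℝ) :=
  AEEqFun.coeFn_mk _ _

lemma distribution_charInterval {a : ℝ} (ha : 0 ≤ a) (b : ℝ) (τ : ℝ≥0∞) :
    distribution (charInterval a b) τ = if τ < 1 then ENNReal.ofReal (b - a) else 0 := by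
  rw [distribution_congr (coeFn_charInterval a b), superlevel_indicator]
  split_ifs with h
  · have : {s : ℝ | τ < ‖(1 : ℝ)‖ₑ} = univ := by simp [h]
    have hsub : Ioo a b ⊆ Ioi 0 := fun t ht => lt_of_le_of_lt ha ht.1
    rw [this, inter_univ, Measure.restrict_apply measurableSet_Ioo, inter_eq_left.2 hsub,
      Real.volume_Ioo]
  · have : {s : ℝ | τ < ‖(1 : ℝ)‖ₑ} = ∅ := by simp [h]
    rw [this, inter_empty, measure_empty]

lemma exists_distribution_pos {y : HalfLineFun} (hy : y ≠ 0) :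
    ∃ c : ℝ, 0 < c ∧ 0 < distribution y (ENNReal.ofReal c) := by
  by_contra! hc
  apply hy
  have h : ∀ n : ℕ, ∀ᵐ s ∂halfLine, ‖y s‖ₑ ≤ ENNReal.ofReal (1 / (n + 1 : ℝ)) := by
    intro n
    have := nonpos_iff_eq_zero.1 (hc (1 / (n + 1 : ℝ)) (by positivity))
    rw [ae_iff]
    simpa [distribution] using this
  ext
  filter_upwards [ae_all_iff.2 h, AEEqFun.coeFn_zero (α := ℝ) (β := ℝ) (μ := halfLine)]
    with s hs h0
  rw [h0, Pi.zero_apply]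
  have hs' : ∀ n : ℕ, ‖y s‖ ≤ 1 / (n + 1 : ℝ) := fun n => by
    have := hs n
    rwa [← ofReal_norm, ENNReal.ofReal_le_ofReal_iff (by positivity)] at this
  exact norm_le_zero_iff.1 (ge_of_tendsto' tendsto_one_div_add_atTop_nhds_zero_nat hs')

lemma RISpace.charInterval_mem_aux (X : RISpace) [Nontrivial X.carrier] :
    ∃ d : ℝ, 0 < d ∧ ∀ a b : ℝ, 0 ≤ a → b - a ≤ d → charInterval a b ∈ X.carrier := by
  obtain ⟨y, hy⟩ := exists_ne (0 : X.carrier)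
  obtain ⟨c, hc, hd⟩ := exists_distribution_pos (y := y.1) (fun h => hy (Subtype.ext h))
  obtain ⟨d, hd0, hd1⟩ : ∃ d : ℝ, 0 < d ∧
      ENNReal.ofReal d ≤ distribution y.1 (ENNReal.ofReal c) := by
    obtain ⟨q, h0, h1⟩ := ENNReal.lt_iff_exists_nnreal_btwn.1 hd
    exact ⟨q, by exact_mod_cast h0, by simpa using h1.le⟩
  refine ⟨d, hd0, fun a b ha hab => ?_⟩
  refine (X.of_distribution_le (charInterval a b) (c⁻¹ • y) fun τ => ?_).1
  rw [distribution_charInterval ha]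
  split_ifs with hτ
  · refine (ENNReal.ofReal_le_ofReal hab).trans (hd1.trans ?_)
    have h : (c⁻¹ • y).1 =ᵐ[halfLine] fun s => c⁻¹ * y.1 s := AEEqFun.coeFn_smul c⁻¹ y.1
    rw [distribution_congr h, distribution]
    refine measure_mono fun s hs => ?_
    have hs' : c < ‖y.1 s‖ := by
      have : ENNReal.ofReal c < ‖y.1 s‖ₑ := hs
      rwa [← ofReal_norm, ENNReal.ofReal_lt_ofReal_iff_of_nonneg hc.le] at this
    refine hτ.trans ?_
    rw [← ofReal_norm, ← ENNReal.ofReal_one, ENNReal.ofReal_lt_ofReal_iff_of_nonneg zero_le_one,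
      norm_mul, Real.norm_of_nonneg (inv_nonneg.2 hc.le), inv_mul_eq_div, one_lt_div hc]
    exact hs'
  · exact zero_le

lemma RISpace.charInterval_mem (X : RISpace) [Nontrivial X.carrier] (t : ℝ) :
    charInterval 0 t ∈ X.carrier := by
  obtain ⟨d, hd, h⟩ := X.charInterval_mem_aux
  suffices H : ∀ n : ℕ, ∀ t : ℝ, t ≤ n * d → charInterval 0 t ∈ X.carrier by
    obtain ⟨n, hn⟩ := exists_nat_ge (t / d)
    exact H n t ((div_le_iff₀ hd).1 hn)
  intro n
  induction n with
  | zero =>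
    intro t ht
    refine h 0 t le_rfl ?_
    simp only [Nat.cast_zero, zero_mul] at ht
    linarith
  | succ n ih =>
    intro t ht
    push_cast at ht
    rcases le_total t (n * d) with h' | h'
    · exact ih t h'
    · have hnd : (0 : ℝ) ≤ n * d := by positivity
      have : charInterval 0 t = charInterval 0 (n * d) + charInterval (n * d) t := by
        ext
        have hne : ∀ᵐ s ∂halfLine, s ≠ n * d :=
          ae_restrict_of_ae (Measure.ae_ne volume _)
        filter_upwards [coeFn_charInterval 0 t, coeFn_charInterval 0 (n * d),
          coeFn_charInterval (n * d) t, AEEqFun.coeFn_add (charInterval 0 (n * d))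
          (charInterval (n * d) t), hne] with s h1 h2 h3 h4 h5
        rw [h4, Pi.add_apply, h1, h2, h3]
        rcases lt_or_gt_of_ne h5 with h6 | h6
        · have e1 : s ∉ Ioo (n * d) t := fun h => absurd h.1 (not_lt.2 h6.le)
          by_cases e0 : 0 < s
          · simp [indicator, e0, h6, h6.trans_le h', not_lt.2 h6.le]
          · simp [indicator, e0, not_lt.2 h6.le]
        · have e0 : 0 < s := lt_of_le_of_lt hnd h6
          simp [indicator, e0, h6, not_lt.2 h6.le]
      rw [this]
      exact X.carrier.add_mem (ih _ le_rfl) (h _ _ hnd (by linarith))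

/-- The fundamental function `φ_X t = ‖χ_A‖_X`, `m A = t`, evaluated at `A = (0, t)`
(the norm does not depend on the choice of `A`). -/
def RISpace.fundamental (X : RISpace) [Nontrivial X.carrier] (t : ℝ) : ℝ :=
  ‖(⟨charInterval 0 t, X.charInterval_mem t⟩ : X.carrier)‖

/-- The class of the characteristic function of a measurable subset of `(0, ∞)`. -/
def charSet (A : Set ℝ) (hA : MeasurableSet A) : HalfLineFun :=
  AEEqFun.mk (A.indicator fun _ => (1 : ℝ))
    (measurable_const.indicator hA).aestronglyMeasurable

/-- The value of the fundamental function can be computed from every set of the given measure. -/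
lemma RISpace.norm_charSet (X : RISpace) [Nontrivial X.carrier] {A : Set ℝ}
    (hA : MeasurableSet A) (h0 : A ⊆ Ioi 0) {t : ℝ} (ht : volume A = ENNReal.ofReal t) :
    ∃ h : charSet A hA ∈ X.carrier,
      ‖(⟨charSet A hA, h⟩ : X.carrier)‖ = X.fundamental t := by
  have hd : ∀ τ, distribution (charSet A hA) τ = distribution (charInterval 0 t) τ := by
    intro τ
    rw [distribution_charInterval le_rfl, charSet, distribution_congr (AEEqFun.coeFn_mk _ _),
      superlevel_indicator]
    split_ifs with h
    · have : {s : ℝ | τ < ‖(1 : ℝ)‖ₑ} = univ := by simp [h]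
      rw [this, inter_univ, Measure.restrict_apply hA, inter_eq_left.2 h0, ht, sub_zero]
    · have : {s : ℝ | τ < ‖(1 : ℝ)‖ₑ} = ∅ := by simp [h]
      rw [this, inter_empty, measure_empty]
  obtain ⟨h, n⟩ := X.of_distribution_le (charSet A hA)
    ⟨charInterval 0 t, X.charInterval_mem t⟩ fun τ => (hd τ).le
  obtain ⟨h', n'⟩ := X.of_distribution_le (charInterval 0 t)
    ⟨charSet A hA, h⟩ fun τ => (hd τ).ge
  exact ⟨h, le_antisymm n n'⟩

/-! ### Dilation functions and dilation indices -/

/-- `M_ψ t = sup_{s > 0} ψ (t s) / ψ s`. -/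
def dilationFn (ψ : ℝ → ℝ) (t : ℝ) : ℝ :=
  sSup ((fun s => ψ (t * s) / ψ s) '' Ioi 0)

/-- `M⁰_ψ t = sup_{0 < s ≤ min (1, 1 / t)} ψ (t s) / ψ s`. -/
def dilationFnZero (ψ : ℝ → ℝ) (t : ℝ) : ℝ :=
  sSup ((fun s => ψ (t * s) / ψ s) '' Ioc 0 (min 1 (1 / t)))

/-- `M^∞_ψ t = sup_{s ≥ max (1, 1 / t)} ψ (t s) / ψ s`. -/
def dilationFnInfty (ψ : ℝ → ℝ) (t : ℝ) : ℝ :=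
  sSup ((fun s => ψ (t * s) / ψ s) '' Ici (max 1 (1 / t)))

/-- `- lim_n (1 / n) log₂ M (2 ^ (-n))`. -/
def lowerIndex (M : ℝ → ℝ) : ℝ :=
  - limUnder atTop fun n : ℕ => 1 / (n : ℝ) * Real.logb 2 (M (2 ^ (-(n : ℤ))))

/-- `lim_n (1 / n) log₂ M (2 ^ n)`. -/
def upperIndex (M : ℝ → ℝ) : ℝ :=
  limUnder atTop fun n : ℕ => 1 / (n : ℝ) * Real.logb 2 (M (2 ^ n))

/-! ### The suprema and the limits in these definitions are finite and exist -/

lemma RISpace.fundamental_mono (X : RISpace) [Nontrivial X.carrier] : Monotone X.fundamental := by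
  intro s t hst
  refine (X.of_distribution_le (charInterval 0 s)
    ⟨charInterval 0 t, X.charInterval_mem t⟩ fun τ => ?_).2
  rw [distribution_charInterval le_rfl, distribution_charInterval le_rfl]
  split_ifs
  · exact ENNReal.ofReal_le_ofReal (by linarith)
  · exact le_rfl

lemma RISpace.fundamental_pos (X : RISpace) [Nontrivial X.carrier] {t : ℝ} (ht : 0 < t) :
    0 < X.fundamental t := by
  refine norm_pos_iff.2 fun h => ?_
  have h0 : charInterval 0 t = 0 := congrArg Subtype.val h
  have h1 := distribution_charInterval le_rfl t 0
  rw [h0, distribution_congr AEEqFun.coeFn_zero] at h1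
  simp only [Pi.zero_apply, enorm_zero, lt_self_iff_false, Set.ofPred_false, measure_empty,
    zero_lt_one, if_true, sub_zero] at h1
  exact absurd (ENNReal.ofReal_pos.2 ht) (by rw [← h1]; exact lt_irrefl _)

lemma RISpace.fundamental_two_mul_le (X : RISpace) [Nontrivial X.carrier] (t : ℝ) :
    X.fundamental (2 * t) ≤ 2 * X.fundamental t := by
  obtain ⟨h, n⟩ := X.dilateTwo_mem ⟨charInterval 0 t, X.charInterval_mem t⟩
  refine le_trans (X.of_distribution_le (charInterval 0 (2 * t)) ⟨_, h⟩ fun τ => ?_).2 n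
  have : charInterval 0 (2 * t) = dilateTwo (charInterval 0 t) := by
    ext
    filter_upwards [coeFn_charInterval 0 (2 * t), coeFn_dilateTwo (charInterval 0 t),
      quasiMeasurePreserving_half.ae (coeFn_charInterval 0 t)] with s h1 h2 h3
    rw [h1, h2, h3]
    have : s ∈ Ioo 0 (2 * t) ↔ s / 2 ∈ Ioo 0 t := by
      constructor <;> rintro ⟨a, b⟩ <;> constructor <;> linarith
    simp only [indicator, this]
  rw [this]

lemma RISpace.fundamental_pow_mul_le (X : RISpace) [Nontrivial X.carrier] (n : ℕ) (t : ℝ) :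
    X.fundamental (2 ^ n * t) ≤ 2 ^ n * X.fundamental t := by
  induction n with
  | zero => simp
  | succ n ih =>
    rw [pow_succ', mul_assoc, mul_assoc]
    exact (X.fundamental_two_mul_le _).trans (by linarith)

lemma RISpace.bddAbove_dilation (X : RISpace) [Nontrivial X.carrier] {D : Set ℝ}
    (hD : D ⊆ Ioi 0) (t : ℝ) :
    BddAbove ((fun s => X.fundamental (t * s) / X.fundamental s) '' D) := by
  obtain ⟨n, hn⟩ := pow_unbounded_of_one_lt t (one_lt_two : (1 : ℝ) < 2)
  refine ⟨2 ^ n, ?_⟩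
  rintro _ ⟨s, hs, rfl⟩
  have hs0 : 0 < s := hD hs
  refine (div_le_iff₀ (X.fundamental_pos hs0)).2 (le_trans (X.fundamental_mono ?_)
    (X.fundamental_pow_mul_le n s))
  exact mul_le_mul_of_nonneg_right hn.le hs0.le

lemma RISpace.exists_tendsto_dilation (X : RISpace) [Nontrivial X.carrier] {b : ℝ}
    (hb : b = 2 ∨ b = 2⁻¹) (D : ℕ → Set ℝ) (hD : ∀ n, D n ⊆ Ioi 0) (hne : ∀ n, (D n).Nonempty)
    (hmul : ∀ m n, ∀ s ∈ D (m + n), s ∈ D m ∧ b ^ m * s ∈ D n) :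
    ∃ l : ℝ, Tendsto (fun n : ℕ => 1 / (n : ℝ) * Real.logb 2
      (sSup ((fun s => X.fundamental (b ^ n * s) / X.fundamental s) '' D n))) atTop (𝓝 l) := by
  have hb0 : 0 < b := by rcases hb with rfl | rfl <;> norm_num
  set M : ℕ → ℝ := fun n =>
    sSup ((fun s => X.fundamental (b ^ n * s) / X.fundamental s) '' D n) with hM
  have hbd : ∀ n, BddAbove ((fun s => X.fundamental (b ^ n * s) / X.fundamental s) '' D n) :=
    fun n => X.bddAbove_dilation (hD n) _
  have hle : ∀ n, ∀ s ∈ D n, X.fundamental (b ^ n * s) / X.fundamental s ≤ M n :=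
    fun n s hs => le_csSup (hbd n) ⟨s, hs, rfl⟩
  have hlow : ∀ n, (2⁻¹ : ℝ) ^ n ≤ M n := by
    intro n
    obtain ⟨s, hs⟩ := hne n
    have hs0 : 0 < s := hD n hs
    refine le_trans ?_ (hle n s hs)
    rw [le_div_iff₀ (X.fundamental_pos hs0), inv_pow, inv_mul_le_iff₀ (by positivity)]
    refine le_trans (X.fundamental_mono ?_) (X.fundamental_pow_mul_le n (b ^ n * s))
    rcases hb with rfl | rfl
    · have : (1 : ℝ) ≤ 2 ^ n := one_le_pow₀ one_le_two
      have h2 : s ≤ 2 ^ n * s := le_mul_of_one_le_left hs0.le this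
      exact h2.trans (le_mul_of_one_le_left (by positivity) this)
    · rw [← mul_assoc, ← mul_pow, mul_inv_cancel₀ two_ne_zero, one_pow, one_mul]
  have hpos : ∀ n, 0 < M n := fun n => lt_of_lt_of_le (by positivity) (hlow n)
  have hsub : Subadditive fun n => Real.logb 2 (M n) := by
    intro m n
    simp only
    rw [← Real.logb_mul (hpos m).ne' (hpos n).ne']
    refine Real.logb_le_logb_of_le one_lt_two (hpos _) (csSup_le ((hne _).image _) ?_)
    rintro _ ⟨s, hs, rfl⟩
    obtain ⟨h1, h2⟩ := hmul m n s hs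
    have p1 := X.fundamental_pos (hD m h1)
    have p2 := X.fundamental_pos (hD n h2)
    have e : X.fundamental (b ^ (m + n) * s) / X.fundamental s =
        X.fundamental (b ^ m * s) / X.fundamental s *
          (X.fundamental (b ^ n * (b ^ m * s)) / X.fundamental (b ^ m * s)) := by
      rw [show b ^ (m + n) * s = b ^ n * (b ^ m * s) by ring]
      rw [div_mul_div_comm, mul_comm (X.fundamental s), mul_div_mul_left _ _ p2.ne']
    simp only [e]
    exact mul_le_mul (hle m s h1) (hle n _ h2)
      (div_nonneg (norm_nonneg _) p2.le) (hpos m).le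
  refine ⟨hsub.lim, ?_⟩
  have hbelow : BddBelow (range fun n : ℕ => Real.logb 2 (M n) / n) := by
    refine ⟨-1, ?_⟩
    rintro _ ⟨n, rfl⟩
    rcases Nat.eq_zero_or_pos n with rfl | hn
    · simp
    · have hn' : (0 : ℝ) < n := by exact_mod_cast hn
      simp only
      rw [le_div_iff₀ hn']
      have := Real.logb_le_logb_of_le one_lt_two (by positivity) (hlow n)
      rw [Real.logb_pow, Real.logb_inv, Real.logb_self_eq_one one_lt_two] at this
      linarith
  refine (hsub.tendsto_lim hbelow).congr fun n => ?_
  rw [div_eq_mul_inv, mul_comm, one_div]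

lemma RISpace.tendsto_lowerIndex (X : RISpace) [Nontrivial X.carrier] :
    Tendsto (fun n : ℕ => 1 / (n : ℝ) * Real.logb 2
      (dilationFn X.fundamental (2 ^ (-(n : ℤ))))) atTop
      (𝓝 (-lowerIndex (dilationFn X.fundamental))) := by
  rw [lowerIndex, neg_neg]
  refine tendsto_nhds_limUnder ?_
  simp only [dilationFn, zpow_neg, zpow_natCast, ← inv_pow]
  exact X.exists_tendsto_dilation (Or.inr rfl) (fun _ => Ioi 0) (fun _ => subset_rfl)
    (fun _ => nonempty_Ioi) fun m n s (hs : 0 < s) =>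
      ⟨hs, show 0 < (2⁻¹ : ℝ) ^ m * s by positivity⟩

lemma RISpace.tendsto_upperIndex (X : RISpace) [Nontrivial X.carrier] :
    Tendsto (fun n : ℕ => 1 / (n : ℝ) * Real.logb 2 (dilationFn X.fundamental (2 ^ n))) atTop
      (𝓝 (upperIndex (dilationFn X.fundamental))) := by
  refine tendsto_nhds_limUnder ?_
  simp only [dilationFn]
  exact X.exists_tendsto_dilation (Or.inl rfl) (fun _ => Ioi 0) (fun _ => subset_rfl)
    (fun _ => nonempty_Ioi) fun m n s (hs : 0 < s) =>
      ⟨hs, show 0 < (2 : ℝ) ^ m * s by positivity⟩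

lemma RISpace.tendsto_lowerIndex_infty (X : RISpace) [Nontrivial X.carrier] :
    Tendsto (fun n : ℕ => 1 / (n : ℝ) * Real.logb 2
      (dilationFnInfty X.fundamental (2 ^ (-(n : ℤ))))) atTop
      (𝓝 (-lowerIndex (dilationFnInfty X.fundamental))) := by
  rw [lowerIndex, neg_neg]
  refine tendsto_nhds_limUnder ?_
  have hD : ∀ n : ℕ, max 1 (1 / (2⁻¹ : ℝ) ^ n) = 2 ^ n := fun n => by
    rw [one_div, inv_pow, inv_inv]
    exact max_eq_right (one_le_pow₀ one_le_two)
  simp only [dilationFnInfty, zpow_neg, zpow_natCast, ← inv_pow, hD]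
  refine X.exists_tendsto_dilation (Or.inr rfl) (fun n => Ici (2 ^ n))
    (fun n s (hs : 2 ^ n ≤ s) => lt_of_lt_of_le (by positivity) hs)
    (fun _ => nonempty_Ici) fun m n s (hs : 2 ^ (m + n) ≤ s) => ⟨?_, ?_⟩
  · refine le_trans ?_ hs
    exact pow_le_pow_right₀ one_le_two (by omega)
  · change (2 : ℝ) ^ n ≤ (2⁻¹ : ℝ) ^ m * s
    rw [inv_pow, le_inv_mul_iff₀ (by positivity), ← pow_add]
    exact hs

lemma RISpace.tendsto_upperIndex_zero (X : RISpace) [Nontrivial X.carrier] :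
    Tendsto (fun n : ℕ => 1 / (n : ℝ) * Real.logb 2 (dilationFnZero X.fundamental (2 ^ n))) atTop
      (𝓝 (upperIndex (dilationFnZero X.fundamental))) := by
  refine tendsto_nhds_limUnder ?_
  have hD : ∀ n : ℕ, min 1 (1 / (2 : ℝ) ^ n) = (2 ^ n)⁻¹ := fun n => by
    rw [one_div]
    exact min_eq_right (inv_le_one_of_one_le₀ (one_le_pow₀ one_le_two))
  simp only [dilationFnZero, hD]
  refine X.exists_tendsto_dilation (Or.inl rfl) (fun n => Ioc 0 ((2 ^ n)⁻¹))
    (fun n s hs => hs.1) (fun n => nonempty_Ioc.2 (by positivity)) fun m n s hs => ⟨⟨hs.1, ?_⟩, ?_⟩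
  · refine hs.2.trans (inv_anti₀ (by positivity) ?_)
    exact pow_le_pow_right₀ one_le_two (by omega)
  · have h0 : 0 < s := hs.1
    refine ⟨by positivity, ?_⟩
    have := hs.2
    rw [pow_add, mul_inv] at this
    rwa [← le_inv_mul_iff₀ (by positivity)]

end

/-!
The doubling operator shifts the functions `χ_(2^k, 2^(k+1))`, which are `1`-unconditional and have
norms `φ (2^k)`. Formally `∑ ev^(-k) χ_(2^k, 2^(k+1))` is an eigenvector for `ev`. Damped by `ρ` at
every step away from an index `c` and cut off at the ends of a window around `c`, it is an
approximate eigenvector as soon as its end terms are small compared with its norm. This happens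
if, for some `r < ev < q`, first `φ (2^k) / r^k` rises by a large factor and then `φ (2^k) / q^k`
falls by a large factor. The indices `μ`, `ν`, `ν⁰`, `μ^∞` yield such falls and rises; the rises
coming from `ν⁰` can be found arbitrarily far to the left and the falls coming from `μ^∞`
arbitrarily far to the right, so that in both cases the rise precedes the fall.
-/

/-! ### Shifted sequences in a normed space -/

section Shift

variable {ι E : Type*} [NormedAddCommGroup E] [NormedSpace ℝ E]

lemma isApproximateEigenvalue_of_forall_pos {T : E →L[ℝ] E} {ev : ℝ}
    (h : ∀ δ : ℝ, 0 < δ → ∃ u : E, u ≠ 0 ∧ ‖T u - ev • u‖ ≤ δ * ‖u‖) :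
    IsApproximateEigenvalue T ev := by
  choose u hu₀ hu using fun n : ℕ => h (1 / (n + 1 : ℝ)) (by positivity)
  have hpos : ∀ n, 0 < ‖u n‖ := fun n => norm_pos_iff.2 (hu₀ n)
  refine ⟨fun n => ‖u n‖⁻¹ • u n, fun n => ?_, ?_⟩
  · rw [norm_smul, norm_inv, norm_norm, inv_mul_cancel₀ (hpos n).ne']
  · refine squeeze_zero (fun _ => norm_nonneg _) (fun n => ?_)
      tendsto_one_div_add_atTop_nhds_zero_nat
    rw [map_smul, smul_comm ev, ← smul_sub, norm_smul, norm_inv, norm_norm,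
      inv_mul_le_iff₀ (hpos n), mul_comm]
    exact hu n

/-- The family `e` is `1`-unconditional: the norm of a finite linear combination is a monotone
function of the absolute values of its coefficients. -/
def IsOneUnconditional (e : ι → E) : Prop :=
  ∀ (S : Finset ι) (c d : ι → ℝ), (∀ k ∈ S, |c k| ≤ |d k|) →
    ‖∑ k ∈ S, c k • e k‖ ≤ ‖∑ k ∈ S, d k • e k‖

lemma IsOneUnconditional.norm_smul_le_norm_sum {e : ι → E} (he : IsOneUnconditional e)
    {S : Finset ι} {k : ι} (hk : k ∈ S) (d : ι → ℝ) :
    ‖d k • e k‖ ≤ ‖∑ l ∈ S, d l • e l‖ := by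
  classical
  have h := he S (fun l => if l = k then d l else 0) d fun l _ => by
    split_ifs with hl
    · exact le_rfl
    · rw [abs_zero]; exact abs_nonneg _
  simpa only [ite_smul, zero_smul, Finset.sum_ite_eq', hk, if_true] using h

lemma map_sum_sub_smul_of_shift {T : E →L[ℝ] E} {e : ℤ → E} (hT : ∀ k, T (e k) = e (k + 1))
    (w : ℤ → ℝ) (ev : ℝ) {i j : ℤ} (hij : i ≤ j) :
    T (∑ k ∈ Finset.Icc i j, w k • e k) - ev • ∑ k ∈ Finset.Icc i j, w k • e k =
      w j • e (j + 1) - w (i - 1) • e i +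
        ∑ k ∈ Finset.Icc i j, (w (k - 1) - ev * w k) • e k := by
  induction j, hij using Int.leInduction with
  | base =>
    simp only [Finset.Icc_self, Finset.sum_singleton, map_smul, hT, sub_smul, mul_smul]
    abel
  | succ j hij ih =>
    have hj : j + 1 ∉ Finset.Icc i j := by simp
    rw [← Finset.insert_Icc_right_eq_Icc_add_one (by omega), Finset.sum_insert hj,
      Finset.sum_insert hj, map_add, smul_add, add_sub_add_comm, ih, map_smul, hT,
      add_sub_cancel_right, sub_smul _ _ (e (j + 1)), mul_smul]
    abel

/-- Only the two end terms and the defect of `w` as an eigenvector of the shift contribute. -/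
lemma norm_map_sum_sub_smul_le_of_shift {T : E →L[ℝ] E} {e : ℤ → E}
    (hT : ∀ k, T (e k) = e (k + 1)) (he : IsOneUnconditional e) {w : ℤ → ℝ} {ev ε η : ℝ}
    (hε : 0 ≤ ε) {i j : ℤ} (hij : i ≤ j)
    (hw : ∀ k ∈ Finset.Icc i j, |w (k - 1) - ev * w k| ≤ ε * |w k|) {u : E}
    (hu : u = ∑ k ∈ Finset.Icc i j, w k • e k)
    (hi : ‖w i • e i‖ ≤ η * ‖u‖) (hj : ‖w j • e j‖ ≤ η * ‖u‖) :
    ‖T u - ev • u‖ ≤ (ε + (‖T‖ + (|ev| + ε)) * η) * ‖u‖ := by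
  have hright : ‖w j • e (j + 1)‖ ≤ ‖T‖ * (η * ‖u‖) := by
    rw [← hT, ← map_smul]
    exact (T.le_opNorm _).trans (mul_le_mul_of_nonneg_left hj (norm_nonneg _))
  have hleft : ‖w (i - 1) • e i‖ ≤ (|ev| + ε) * (η * ‖u‖) := by
    have hwi : |w (i - 1)| ≤ (|ev| + ε) * |w i| := by
      calc |w (i - 1)| = |ev * w i + (w (i - 1) - ev * w i)| := by rw [add_sub_cancel]
        _ ≤ |ev * w i| + |w (i - 1) - ev * w i| := abs_add_le _ _
        _ ≤ |ev| * |w i| + ε * |w i| := by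
          rw [abs_mul]
          exact add_le_add_right (hw i (Finset.left_mem_Icc.2 hij)) _
        _ = (|ev| + ε) * |w i| := by ring
    calc ‖w (i - 1) • e i‖ = |w (i - 1)| * ‖e i‖ := norm_smul _ _
      _ ≤ (|ev| + ε) * |w i| * ‖e i‖ := mul_le_mul_of_nonneg_right hwi (norm_nonneg _)
      _ = (|ev| + ε) * ‖w i • e i‖ := by rw [norm_smul, Real.norm_eq_abs, mul_assoc]
      _ ≤ (|ev| + ε) * (η * ‖u‖) := mul_le_mul_of_nonneg_left hi (by positivity)
  have hmiddle : ‖∑ k ∈ Finset.Icc i j, (w (k - 1) - ev * w k) • e k‖ ≤ ε * ‖u‖ := by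
    refine (he _ _ (fun k => ε * w k) fun k hk => ?_).trans_eq ?_
    · rw [abs_mul, abs_of_nonneg hε]
      exact hw k hk
    · simp only [mul_smul]
      rw [← Finset.smul_sum, ← hu, norm_smul, Real.norm_of_nonneg hε]
  calc ‖T u - ev • u‖
      = ‖w j • e (j + 1) - w (i - 1) • e i +
          ∑ k ∈ Finset.Icc i j, (w (k - 1) - ev * w k) • e k‖ := by
        rw [hu, map_sum_sub_smul_of_shift hT w ev hij]
    _ ≤ ‖T‖ * (η * ‖u‖) + (|ev| + ε) * (η * ‖u‖) + ε * ‖u‖ :=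
        (norm_add_le _ _).trans
          (add_le_add ((norm_sub_le _ _).trans (add_le_add hright hleft)) hmiddle)
    _ = (ε + (‖T‖ + (|ev| + ε)) * η) * ‖u‖ := by ring

end Shift

section PeakWeight

/-- The coefficients `ev ^ (-k)` of a formal eigenvector of the shift for the eigenvalue `ev`,
damped by the factor `ρ` at every step away from the index `c`. -/
noncomputable def peakWeight (ev ρ : ℝ) (c k : ℤ) : ℝ := ev ^ (-k) * ρ ^ (-|k - c|)

variable {ev ρ : ℝ} {c k : ℤ}

lemma peakWeight_pos (hev : 0 < ev) (hρ : 0 < ρ) (c k : ℤ) : 0 < peakWeight ev ρ c k :=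
  mul_pos (zpow_pos hev _) (zpow_pos hρ _)

lemma peakWeight_of_le (hρ : ρ ≠ 0) (hk : k ≤ c) :
    peakWeight ev ρ c k = ρ ^ (-c) / (ev / ρ) ^ k := by
  rw [peakWeight, abs_of_nonpos (by omega), show -(-(k - c)) = -c + k by ring, zpow_add₀ hρ,
    zpow_neg ev, div_zpow, div_div_eq_mul_div, inv_mul_eq_div]

lemma peakWeight_of_ge (hρ : ρ ≠ 0) (hk : c ≤ k) :
    peakWeight ev ρ c k = ρ ^ c / (ev * ρ) ^ k := by
  rw [peakWeight, abs_of_nonneg (by omega), show -(k - c) = c - k by ring, zpow_sub₀ hρ,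
    zpow_neg ev, mul_zpow, inv_mul_eq_div, div_div, mul_comm]

lemma abs_peakWeight_sub_one_sub_le (hev : 0 < ev) (hρ : 1 < ρ) (c k : ℤ) :
    |peakWeight ev ρ c (k - 1) - ev * peakWeight ev ρ c k| ≤
      (ρ - 1) * ev * |peakWeight ev ρ c k| := by
  have hρ₀ : 0 < ρ := one_pos.trans hρ
  rw [abs_of_pos (peakWeight_pos hev hρ₀ c k)]
  set x := ev * peakWeight ev ρ c k with hx
  have hx₀ : 0 < x := mul_pos hev (peakWeight_pos hev hρ₀ c k)
  rw [mul_assoc, ← hx]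
  rcases le_or_gt k c with hk | hk
  · have hstep : peakWeight ev ρ c (k - 1) = ρ⁻¹ * x := by
      rw [hx, peakWeight_of_le hρ₀.ne' hk, peakWeight_of_le hρ₀.ne' (by omega),
        zpow_sub_one₀ (div_pos hev hρ₀).ne']
      field_simp
    have hinv : 1 - ρ⁻¹ ≤ ρ - 1 := by
      nlinarith [mul_inv_cancel₀ hρ₀.ne', inv_pos.2 hρ₀, sq_nonneg (ρ - 1)]
    rw [hstep, show ρ⁻¹ * x - x = -((1 - ρ⁻¹) * x) by ring, abs_neg, abs_of_nonneg
      (mul_nonneg (sub_nonneg.2 (inv_le_one_of_one_le₀ hρ.le)) hx₀.le)]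
    exact mul_le_mul_of_nonneg_right hinv hx₀.le
  · have hstep : peakWeight ev ρ c (k - 1) = ρ * x := by
      rw [hx, peakWeight_of_ge hρ₀.ne' hk.le, peakWeight_of_ge hρ₀.ne' (by omega),
        zpow_sub_one₀ (mul_pos hev hρ₀).ne']
      field_simp
    rw [hstep, show ρ * x - x = (ρ - 1) * x by ring,
      abs_of_pos (mul_pos (sub_pos.2 hρ) hx₀)]

end PeakWeight

/-! ### Rises and falls of a sequence -/

section RisesAndFalls

variable {a b : ℤ → ℝ} {I : Set ℤ} {M : ℤ}

/-- Within `I`, the sequence `a` increases by arbitrarily large factors. -/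
def RisesOn (a : ℤ → ℝ) (I : Set ℤ) : Prop :=
  ∀ K : ℝ, ∃ i ∈ I, ∃ j ∈ I, i ≤ j ∧ K * a i ≤ a j

/-- Within `I`, the sequence `a` decreases by arbitrarily large factors. -/
def FallsOn (a : ℤ → ℝ) (I : Set ℤ) : Prop :=
  ∀ K : ℝ, ∃ i ∈ I, ∃ j ∈ I, i ≤ j ∧ K * a j ≤ a i

/-- The sequence `a` increases by the factor `K`, and afterwards `b` decreases by this factor.
For `a k = x k / r ^ k` and `b k = x k / q ^ k` with `r < q`, such a window makes `x` peak, when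
compared with any geometric sequence of ratio between `r` and `q`. -/
def RisesThenFalls (a b : ℤ → ℝ) (K : ℝ) : Prop :=
  ∃ i₁ j₁ i₂ j₂ : ℤ, i₁ ≤ j₁ ∧ j₁ ≤ i₂ ∧ i₂ ≤ j₂ ∧ K * a i₁ ≤ a j₁ ∧ K * b j₂ ≤ b i₂

lemma fallsOn_iff_risesOn_neg : FallsOn a I ↔ RisesOn (fun k => a (-k)) {k | -k ∈ I} := by
  constructor
  · intro h K
    obtain ⟨i, hi, j, hj, hij, hK⟩ := h K
    exact ⟨-j, by simpa using hj, -i, by simpa using hi, neg_le_neg hij, by simpa using hK⟩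
  · intro h K
    obtain ⟨i, hi, j, hj, hij, hK⟩ := h K
    exact ⟨-j, hj, -i, hi, neg_le_neg hij, hK⟩

/-- A rise that ends at `N + 1` instead of `N` loses at most the factor `a (N + 1) / a N`. -/
lemma RisesOn.Iic_of_Iic_add_one (ha : ∀ k, 0 < a k) {N : ℤ} (h : RisesOn a (Iic (N + 1))) :
    RisesOn a (Iic N) := by
  intro K
  rcases le_or_gt K 1 with hK | hK
  · exact ⟨N, self_mem_Iic, N, self_mem_Iic, le_rfl, mul_le_of_le_one_left (ha N).le hK⟩
  set C := max 1 (a (N + 1) / a N)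
  have hC₁ : 1 ≤ C := le_max_left _ _
  obtain ⟨i, hi, j, hj, hij, hr⟩ := h (C * K)
  have hlarge : K * a i ≤ C * K * a i :=
    mul_le_mul_of_nonneg_right (le_mul_of_one_le_left (by positivity) hC₁) (ha i).le
  rcases (mem_Iic.1 hj).lt_or_eq with hjN | rfl
  · exact ⟨i, by simp only [mem_Iic]; omega, j, by simp only [mem_Iic]; omega, hij,
      hlarge.trans hr⟩
  have hi' : i ≠ N + 1 := by
    rintro rfl
    nlinarith [ha (N + 1)]
  refine ⟨i, by simp only [mem_Iic]; omega, N, self_mem_Iic, by omega, ?_⟩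
  refine le_of_mul_le_mul_left ?_ (one_pos.trans_le hC₁)
  calc C * (K * a i) = C * K * a i := (mul_assoc _ _ _).symm
    _ ≤ a (N + 1) := hr
    _ ≤ C * a N := (div_le_iff₀ (ha N)).1 (le_max_right _ _)

lemma RisesOn.Iic_of_Iic (ha : ∀ k, 0 < a k) (h : RisesOn a (Iic M)) (N : ℤ) :
    RisesOn a (Iic N) := by
  rcases le_total M N with hMN | hNM
  · intro K
    obtain ⟨i, hi, j, hj, hK⟩ := h K
    exact ⟨i, Iic_subset_Iic.2 hMN hi, j, Iic_subset_Iic.2 hMN hj, hK⟩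
  · induction N, hNM using Int.leInductionDown with
    | base => exact h
    | pred N _ ih => exact RisesOn.Iic_of_Iic_add_one ha (by rwa [sub_add_cancel])

lemma FallsOn.Ici_of_Ici (ha : ∀ k, 0 < a k) (h : FallsOn a (Ici M)) (N : ℤ) :
    FallsOn a (Ici N) := by
  have hneg : ∀ L : ℤ, {k : ℤ | -k ∈ Ici L} = Iic (-L) := fun L => by
    ext k
    exact (le_neg : L ≤ -k ↔ k ≤ -L)
  rw [fallsOn_iff_risesOn_neg, hneg] at h ⊢
  exact h.Iic_of_Iic (fun k => ha (-k)) (-N)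

lemma RisesOn.risesThenFalls_of_Iic (ha : ∀ k, 0 < a k) (hr : RisesOn a (Iic M))
    (hf : FallsOn b univ) (K : ℝ) : RisesThenFalls a b K := by
  obtain ⟨i₂, -, j₂, -, h₂, hK₂⟩ := hf K
  obtain ⟨i₁, -, j₁, hj₁, h₁, hK₁⟩ := hr.Iic_of_Iic ha i₂ K
  exact ⟨i₁, j₁, i₂, j₂, h₁, hj₁, h₂, hK₁, hK₂⟩

lemma RisesOn.risesThenFalls_of_Ici (hb : ∀ k, 0 < b k) (hr : RisesOn a univ)
    (hf : FallsOn b (Ici M)) (K : ℝ) : RisesThenFalls a b K := by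
  obtain ⟨i₁, -, j₁, -, h₁, hK₁⟩ := hr K
  obtain ⟨i₂, hi₂, j₂, -, h₂, hK₂⟩ := hf.Ici_of_Ici hb j₁ K
  exact ⟨i₁, j₁, i₂, j₂, h₁, hi₂, h₂, hK₁, hK₂⟩

end RisesAndFalls

section ShiftEigenvalue

variable {E : Type*} [NormedAddCommGroup E] [NormedSpace ℝ E] {T : E →L[ℝ] E} {e : ℤ → E}
  {ev : ℝ}

lemma exists_norm_map_sub_smul_le_of_risesThenFalls (hT : ∀ k, T (e k) = e (k + 1))
    (he : IsOneUnconditional e) (he₀ : ∀ k, e k ≠ 0) {ρ K : ℝ} (hev : 0 < ev) (hρ : 1 < ρ)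
    (hK : 0 < K)
    (h : RisesThenFalls (fun k => ‖e k‖ / (ev / ρ) ^ k) (fun k => ‖e k‖ / (ev * ρ) ^ k) K) :
    ∃ u : E, u ≠ 0 ∧ ‖T u - ev • u‖ ≤ ((ρ - 1) * ev + (‖T‖ + ρ * ev) * K⁻¹) * ‖u‖ := by
  obtain ⟨i₁, j₁, i₂, j₂, h₁, h₁₂, h₂, hrise, hfall⟩ := h
  have hρ₀ : 0 < ρ := one_pos.trans hρ
  set w := peakWeight ev ρ j₁ with hw
  set u := ∑ k ∈ Finset.Icc i₁ j₂, w k • e k with hu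
  have hterm : ∀ k, i₁ ≤ k → k ≤ j₂ → ‖w k • e k‖ ≤ ‖u‖ := fun k hik hkj =>
    he.norm_smul_le_norm_sum (Finset.mem_Icc.2 ⟨hik, hkj⟩) w
  have hnorm : ∀ k, ‖w k • e k‖ = w k * ‖e k‖ := fun k => by
    rw [norm_smul, Real.norm_of_nonneg (peakWeight_pos hev hρ₀ _ _).le]
  have hleft : ∀ k ≤ j₁, ‖w k • e k‖ = ρ ^ (-j₁) * (‖e k‖ / (ev / ρ) ^ k) := fun k hk => by
    rw [hnorm, hw, peakWeight_of_le hρ₀.ne' hk, div_mul_comm, mul_comm]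
  have hright : ∀ k, j₁ ≤ k → ‖w k • e k‖ = ρ ^ j₁ * (‖e k‖ / (ev * ρ) ^ k) := fun k hk => by
    rw [hnorm, hw, peakWeight_of_ge hρ₀.ne' hk, div_mul_comm, mul_comm]
  have hend₁ : ‖w i₁ • e i₁‖ ≤ K⁻¹ * ‖u‖ := by
    refine (le_inv_mul_iff₀ hK).2 (le_trans ?_ (hterm j₁ h₁ (h₁₂.trans h₂)))
    rw [hleft _ h₁, hleft _ le_rfl, mul_left_comm]
    exact mul_le_mul_of_nonneg_left hrise (zpow_pos hρ₀ _).le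
  have hend₂ : ‖w j₂ • e j₂‖ ≤ K⁻¹ * ‖u‖ := by
    refine (le_inv_mul_iff₀ hK).2 (le_trans ?_ (hterm i₂ (h₁.trans h₁₂) h₂))
    rw [hright _ (h₁₂.trans h₂), hright _ h₁₂, mul_left_comm]
    exact mul_le_mul_of_nonneg_left hfall (zpow_pos hρ₀ _).le
  refine ⟨u, norm_pos_iff.1 (lt_of_lt_of_le ?_ (hterm j₁ h₁ (h₁₂.trans h₂))), ?_⟩
  · exact norm_pos_iff.2 (smul_ne_zero (peakWeight_pos hev hρ₀ _ _).ne' (he₀ j₁))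
  refine (norm_map_sum_sub_smul_le_of_shift hT he (by nlinarith) (h₁.trans (h₁₂.trans h₂))
    (fun k _ => abs_peakWeight_sub_one_sub_le hev hρ j₁ k) hu hend₁ hend₂).trans_eq ?_
  rw [abs_of_pos hev]
  ring

theorem isApproximateEigenvalue_of_shift (hT : ∀ k, T (e k) = e (k + 1))
    (he : IsOneUnconditional e) (he₀ : ∀ k, e k ≠ 0) (hev : 0 < ev)
    (h : ∀ r ∈ Ioo 0 ev, ∀ q ∈ Ioi ev, ∀ K : ℝ,
      RisesThenFalls (fun k => ‖e k‖ / r ^ k) (fun k => ‖e k‖ / q ^ k) K) :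
    IsApproximateEigenvalue T ev := by
  refine isApproximateEigenvalue_of_forall_pos fun δ hδ => ?_
  set ρ := 1 + δ / (2 * ev) with hρ
  have hρ₁ : 1 < ρ := lt_add_of_pos_right 1 (by positivity)
  have hC : 0 < ‖T‖ + ρ * ev := by positivity
  obtain ⟨u, hu₀, hu⟩ := exists_norm_map_sub_smul_le_of_risesThenFalls hT he he₀ hev hρ₁
    (div_pos hC (half_pos hδ)) (h _ ⟨by positivity, div_lt_self hev hρ₁⟩ _
      (lt_mul_of_one_lt_right hev hρ₁) _)
  refine ⟨u, hu₀, hu.trans_eq ?_⟩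
  rw [inv_div, mul_div_cancel₀ _ hC.ne', hρ]
  field_simp
  ring

end ShiftEigenvalue


/-! ### Dyadic blocks in a rearrangement invariant space -/

section DisjointSupport

variable {ι : Type*}

lemma abs_sum_mul_le_abs_sum_mul_of_disjoint {S : Finset ι} {c d v : ι → ℝ}
    (hv : ∀ i j, i ≠ j → v i = 0 ∨ v j = 0) (hcd : ∀ i ∈ S, |c i| ≤ |d i|) :
    |∑ i ∈ S, c i * v i| ≤ |∑ i ∈ S, d i * v i| := by
  by_cases h : ∃ k ∈ S, v k ≠ 0
  · obtain ⟨k, hk, hvk⟩ := h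
    have hsum : ∀ f : ι → ℝ, ∑ i ∈ S, f i * v i = f k * v k := fun f =>
      Finset.sum_eq_single_of_mem k hk fun i _ hik => by
        rw [(hv i k hik).resolve_right hvk, mul_zero]
    rw [hsum, hsum, abs_mul, abs_mul]
    exact mul_le_mul_of_nonneg_right (hcd k hk) (abs_nonneg _)
  · push Not at h
    rw [Finset.sum_eq_zero fun i hi => by rw [h i hi, mul_zero], abs_zero]
    exact abs_nonneg _

lemma RISpace.coeFn_sum_smul (X : RISpace) (S : Finset ι) (c : ι → ℝ) (x : ι → X.carrier) :
    (∑ k ∈ S, c k • x k : X.carrier).1 =ᵐ[halfLine] fun s => ∑ k ∈ S, c k * (x k).1 s := by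
  have hsmul : ∀ᵐ s ∂halfLine, ∀ k ∈ S, (c k • (x k).1 : HalfLineFun) s = c k * (x k).1 s :=
    (Finset.eventually_all S).2 fun k _ => AEEqFun.coeFn_smul (c k) (x k).1
  rw [AddSubmonoidClass.coe_finsetSum]
  filter_upwards [AEEqFun.coeFn_fun_finsetSum S fun k => c k • (x k).1, hsmul] with s hs hsmul
  exact hs.trans (Finset.sum_congr rfl hsmul)

lemma RISpace.isOneUnconditional_of_disjoint [Countable ι] (X : RISpace) {x : ι → X.carrier}
    (hx : ∀ i j, i ≠ j → ∀ᵐ s ∂halfLine, (x i).1 s = 0 ∨ (x j).1 s = 0) :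
    IsOneUnconditional x := by
  intro S c d hcd
  have hdisj : ∀ᵐ s ∂halfLine, ∀ i j, i ≠ j → (x i).1 s = 0 ∨ (x j).1 s = 0 := by
    simpa only [ae_all_iff] using hx
  refine (X.isRearrangementInvariant.ideal (∑ k ∈ S, c k • x k : X.carrier).1 _ ?_).2
  filter_upwards [X.coeFn_sum_smul S c x, X.coeFn_sum_smul S d x, hdisj] with s hc hd hs
  rw [hc, hd]
  exact abs_sum_mul_le_abs_sum_mul_of_disjoint hs hcd

end DisjointSupport

lemma dilateTwo_charInterval (a b : ℝ) :
    dilateTwo (charInterval a b) = charInterval (2 * a) (2 * b) := by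
  ext
  filter_upwards [coeFn_charInterval (2 * a) (2 * b), coeFn_dilateTwo (charInterval a b),
    quasiMeasurePreserving_half.ae (coeFn_charInterval a b)] with s hlarge hdilate hsmall
  have hmem : s ∈ Ioo (2 * a) (2 * b) ↔ s / 2 ∈ Ioo a b := by
    rw [mem_Ioo, mem_Ioo, lt_div_iff₀' two_pos, div_lt_iff₀' two_pos]
  simp only [hlarge, hdilate, hsmall, indicator, hmem]

section DyadicBlock

variable (X : RISpace) [Nontrivial X.carrier]

lemma RISpace.norm_charInterval {a : ℝ} (ha : 0 ≤ a) (b : ℝ) :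
    ∃ h : charInterval a b ∈ X.carrier,
      ‖(⟨charInterval a b, h⟩ : X.carrier)‖ = X.fundamental (b - a) :=
  X.norm_charSet measurableSet_Ioo (fun _ hs => ha.trans_lt hs.1) Real.volume_Ioo

/-- The characteristic function of `(2 ^ k, 2 ^ (k + 1))` as an element of `X`; the doubling
operator shifts these functions. -/
noncomputable def RISpace.dyadicBlock (k : ℤ) : X.carrier :=
  ⟨charInterval (2 ^ k) (2 ^ (k + 1)), (X.norm_charInterval (zpow_pos two_pos k).le _).1⟩

lemma RISpace.norm_dyadicBlock (k : ℤ) : ‖X.dyadicBlock k‖ = X.fundamental (2 ^ k) := by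
  refine (X.norm_charInterval (zpow_pos two_pos k).le _).2.trans ?_
  rw [zpow_add_one₀ two_ne_zero, mul_two, add_sub_cancel_right]

lemma RISpace.dyadicBlock_ne_zero (k : ℤ) : X.dyadicBlock k ≠ 0 := by
  rw [← norm_pos_iff, X.norm_dyadicBlock]
  exact X.fundamental_pos (zpow_pos two_pos k)

lemma RISpace.doubling_dyadicBlock (k : ℤ) :
    X.doubling (X.dyadicBlock k) = X.dyadicBlock (k + 1) := by
  refine Subtype.ext ((dilateTwo_charInterval _ _).trans ?_)
  rw [← zpow_one_add₀ two_ne_zero, ← zpow_one_add₀ two_ne_zero, add_comm 1, add_comm 1]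
  rfl

lemma RISpace.isOneUnconditional_dyadicBlock : IsOneUnconditional X.dyadicBlock := by
  refine X.isOneUnconditional_of_disjoint fun i j hij => ?_
  have hdisj : Disjoint (Ioo ((2 : ℝ) ^ i) (2 ^ (i + 1))) (Ioo (2 ^ j) (2 ^ (j + 1))) :=
    (zpow_right_mono₀ one_le_two).pairwise_disjoint_on_Ioo_succ hij
  filter_upwards [coeFn_charInterval (2 ^ i) (2 ^ (i + 1)),
    coeFn_charInterval (2 ^ j) (2 ^ (j + 1))] with s hi hj
  by_cases hs : s ∈ Ioo ((2 : ℝ) ^ i) (2 ^ (i + 1))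
  · exact Or.inr (hj.trans (indicator_of_notMem (disjoint_left.1 hdisj hs) _))
  · exact Or.inl (hi.trans (indicator_of_notMem hs _))

end DyadicBlock

/-! ### Growth of the fundamental function along dyadic scales -/

lemma eventually_mul_pow_lt_of_tendsto_logb {M : ℕ → ℝ} (hM : ∀ n, 0 < M n) {l r : ℝ}
    (hl : Tendsto (fun n : ℕ => 1 / (n : ℝ) * Real.logb 2 (M n)) atTop (𝓝 l)) (hr₀ : 0 < r)
    (hr : r < 2 ^ l) (K : ℝ) : ∀ᶠ n : ℕ in atTop, K * r ^ n < M n := by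
  obtain ⟨q, hrq, hq⟩ := exists_between hr
  have hq₀ : 0 < q := hr₀.trans hrq
  have hlog : Real.logb 2 q < l := (Real.logb_lt_iff_lt_rpow one_lt_two hq₀).2 hq
  filter_upwards [hl.eventually (lt_mem_nhds hlog), eventually_gt_atTop 0,
    (tendsto_pow_atTop_atTop_of_one_lt ((one_lt_div hr₀).2 hrq)).eventually_ge_atTop K]
    with n hn hn₀ hK
  rw [one_div, lt_inv_mul_iff₀ (Nat.cast_pos.2 hn₀), ← Real.logb_pow,
    Real.logb_lt_logb_iff one_lt_two (pow_pos hq₀ n) (hM n)] at hn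
  rw [div_pow, le_div_iff₀ (pow_pos hr₀ n)] at hK
  exact hK.trans_lt hn

lemma mul_div_zpow_le_div_zpow_add_iff {r : ℝ} (hr : 0 < r) {x y K : ℝ} {k m : ℤ} :
    K * (x / r ^ k) ≤ y / r ^ (k + m) ↔ K * r ^ m * x ≤ y := by
  rw [le_div_iff₀ (zpow_pos hr _), zpow_add₀ hr.ne']
  have hrk : r ^ k ≠ 0 := (zpow_pos hr k).ne'
  rw [show K * (x / r ^ k) * (r ^ k * r ^ m) = K * r ^ m * x by field_simp]

section Fundamental

variable (X : RISpace) [Nontrivial X.carrier]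

lemma RISpace.sSup_dilation_pos {D : Set ℝ} (hD : D ⊆ Ioi 0) (hne : D.Nonempty) {t : ℝ}
    (ht : 0 < t) : 0 < sSup ((fun s => X.fundamental (t * s) / X.fundamental s) '' D) := by
  obtain ⟨s, hs⟩ := hne
  have hs₀ : 0 < s := hD hs
  exact (div_pos (X.fundamental_pos (mul_pos ht hs₀)) (X.fundamental_pos hs₀)).trans_le
    (le_csSup (X.bddAbove_dilation hD t) (mem_image_of_mem _ hs))

lemma RISpace.fundamental_zpow_log_le {s : ℝ} (hs : 0 < s) :
    X.fundamental (2 ^ Int.log 2 s) ≤ X.fundamental s :=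
  X.fundamental_mono (by exact_mod_cast Int.zpow_log_le_self one_lt_two hs)

lemma RISpace.fundamental_zpow_mul_le (m : ℤ) (s : ℝ) :
    X.fundamental (2 ^ m * s) ≤ 2 * X.fundamental (2 ^ (Int.log 2 s + m)) := by
  refine (X.fundamental_mono ?_).trans (X.fundamental_two_mul_le _)
  have hs : s < 2 ^ (Int.log 2 s + 1) := by
    exact_mod_cast Int.lt_zpow_succ_log_self one_lt_two s
  calc (2 : ℝ) ^ m * s ≤ 2 ^ m * 2 ^ (Int.log 2 s + 1) := by gcongr
    _ = 2 * 2 ^ (Int.log 2 s + m) := by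
      rw [← zpow_add₀ two_ne_zero, ← zpow_one_add₀ two_ne_zero]
      congr 1
      ring

/-- Rounding `s` down to the power `2 ^ Int.log 2 s` costs at most a factor `2`, which `K`
absorbs. -/
lemma RISpace.exists_mul_pow_mul_fundamental_zpow_le {D : ℕ → Set ℝ} (hD : ∀ n, D n ⊆ Ioi 0)
    (hne : ∀ n, (D n).Nonempty) {m : ℕ → ℤ} {l r : ℝ}
    (hl : Tendsto (fun n : ℕ => 1 / (n : ℝ) * Real.logb 2
      (sSup ((fun s => X.fundamental (2 ^ m n * s) / X.fundamental s) '' D n))) atTop (𝓝 l))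
    (hr₀ : 0 < r) (hr : r < 2 ^ l) (K : ℝ) :
    ∃ n, ∃ s ∈ D n, K * r ^ n * X.fundamental (2 ^ Int.log 2 s) ≤
      X.fundamental (2 ^ (Int.log 2 s + m n)) := by
  obtain ⟨n, hn⟩ := (eventually_mul_pow_lt_of_tendsto_logb
    (fun n => X.sSup_dilation_pos (hD n) (hne n) (zpow_pos two_pos (m n))) hl hr₀ hr
    (2 * |K|)).exists
  obtain ⟨_, ⟨s, hs, rfl⟩, hlt⟩ := exists_lt_of_lt_csSup ((hne n).image _) hn
  have hs₀ : 0 < s := hD n hs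
  have hφ : 0 < X.fundamental (2 ^ Int.log 2 s) := X.fundamental_pos (zpow_pos two_pos _)
  refine ⟨n, s, hs, le_of_mul_le_mul_left ?_ two_pos⟩
  calc 2 * (K * r ^ n * X.fundamental (2 ^ Int.log 2 s))
      ≤ 2 * (|K| * r ^ n * X.fundamental s) := by
        gcongr
        · exact le_abs_self K
        · exact X.fundamental_zpow_log_le hs₀
    _ = 2 * |K| * r ^ n * X.fundamental s := by ring
    _ ≤ X.fundamental (2 ^ m n * s) := ((lt_div_iff₀ (X.fundamental_pos hs₀)).1 hlt).le
    _ ≤ 2 * X.fundamental (2 ^ (Int.log 2 s + m n)) := X.fundamental_zpow_mul_le (m n) s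

variable {X} {D : ℕ → Set ℝ} {I : Set ℤ} {r : ℝ}

lemma RISpace.risesOn_of_tendsto (hD : ∀ n, D n ⊆ Ioi 0) (hne : ∀ n, (D n).Nonempty) {l : ℝ}
    (hl : Tendsto (fun n : ℕ => 1 / (n : ℝ) * Real.logb 2
      (sSup ((fun s => X.fundamental (2 ^ n * s) / X.fundamental s) '' D n))) atTop (𝓝 l))
    (hr₀ : 0 < r) (hr : r < 2 ^ l)
    (hI : ∀ n, ∀ s ∈ D n, Int.log 2 s ∈ I ∧ Int.log 2 s + n ∈ I) :
    RisesOn (fun k => X.fundamental (2 ^ k) / r ^ k) I := by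
  intro K
  obtain ⟨n, s, hs, hK⟩ := X.exists_mul_pow_mul_fundamental_zpow_le (m := fun n => n) hD hne
    (by simpa only [zpow_natCast] using hl) hr₀ hr K
  refine ⟨_, (hI n s hs).1, _, (hI n s hs).2, le_add_of_nonneg_right n.cast_nonneg,
    (mul_div_zpow_le_div_zpow_add_iff hr₀).2 ?_⟩
  rwa [zpow_natCast]

lemma RISpace.fallsOn_of_tendsto (hD : ∀ n, D n ⊆ Ioi 0) (hne : ∀ n, (D n).Nonempty) {l : ℝ}
    (hl : Tendsto (fun n : ℕ => 1 / (n : ℝ) * Real.logb 2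
      (sSup ((fun s => X.fundamental (2 ^ (-(n : ℤ)) * s) / X.fundamental s) '' D n)))
      atTop (𝓝 (-l)))
    (hr : 2 ^ l < r) (hI : ∀ n, ∀ s ∈ D n, Int.log 2 s - n ∈ I ∧ Int.log 2 s ∈ I) :
    FallsOn (fun k => X.fundamental (2 ^ k) / r ^ k) I := by
  intro K
  have hl₀ : (0 : ℝ) < 2 ^ l := Real.rpow_pos_of_pos two_pos l
  have hr₀ : 0 < r := hl₀.trans hr
  have hr' : r⁻¹ < 2 ^ (-l) := by
    rw [Real.rpow_neg two_pos.le]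
    exact inv_strictAnti₀ hl₀ hr
  obtain ⟨n, s, hs, hK⟩ :=
    X.exists_mul_pow_mul_fundamental_zpow_le hD hne hl (inv_pos.2 hr₀) hr' K
  refine ⟨_, (hI n s hs).1, _, (hI n s hs).2, sub_le_self _ n.cast_nonneg, ?_⟩
  rw [sub_eq_add_neg, mul_div_zpow_le_div_zpow_add_iff hr₀, zpow_neg, zpow_natCast, ← inv_pow]
  exact hK

lemma RISpace.risesOn_univ_of_lt_upperIndex (hr₀ : 0 < r)
    (hr : r < 2 ^ upperIndex (dilationFn X.fundamental)) :
    RisesOn (fun k => X.fundamental (2 ^ k) / r ^ k) univ :=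
  risesOn_of_tendsto (D := fun _ => Ioi 0) (fun _ => subset_rfl) (fun _ => nonempty_Ioi)
    X.tendsto_upperIndex hr₀ hr fun _ _ _ => ⟨mem_univ _, mem_univ _⟩

lemma RISpace.risesOn_Iic_of_lt_upperIndex_zero (hr₀ : 0 < r)
    (hr : r < 2 ^ upperIndex (dilationFnZero X.fundamental)) :
    RisesOn (fun k => X.fundamental (2 ^ k) / r ^ k) (Iic 0) := by
  refine risesOn_of_tendsto (D := fun n => Ioc 0 (min 1 (1 / 2 ^ n))) (fun _ _ hs => hs.1)
    (fun _ => nonempty_Ioc.2 (by positivity)) X.tendsto_upperIndex_zero hr₀ hr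
    fun n s hs => ?_
  have hlog : Int.log 2 s ≤ -(n : ℤ) := by
    rw [← Int.lt_add_one_iff, ← Int.lt_zpow_iff_log_lt one_lt_two hs.1, Nat.cast_ofNat]
    calc s ≤ 1 / 2 ^ n := hs.2.trans (min_le_right _ _)
      _ = 2 ^ (-(n : ℤ)) := by rw [zpow_neg, zpow_natCast, one_div]
      _ < 2 ^ (-(n : ℤ) + 1) := zpow_lt_zpow_right₀ one_lt_two (lt_add_one _)
  simp only [mem_Iic]
  omega

lemma RISpace.fallsOn_univ_of_lowerIndex_lt
    (hr : 2 ^ lowerIndex (dilationFn X.fundamental) < r) :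
    FallsOn (fun k => X.fundamental (2 ^ k) / r ^ k) univ :=
  fallsOn_of_tendsto (D := fun _ => Ioi 0) (fun _ => subset_rfl) (fun _ => nonempty_Ioi)
    X.tendsto_lowerIndex hr fun _ _ _ => ⟨mem_univ _, mem_univ _⟩

lemma RISpace.fallsOn_Ici_of_lowerIndex_infty_lt
    (hr : 2 ^ lowerIndex (dilationFnInfty X.fundamental) < r) :
    FallsOn (fun k => X.fundamental (2 ^ k) / r ^ k) (Ici 0) := by
  have hpos : ∀ (n : ℕ) (s : ℝ), s ∈ Ici (max 1 (1 / (2 : ℝ) ^ (-(n : ℤ)))) → 0 < s :=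
    fun _ _ hs => one_pos.trans_le ((le_max_left _ _).trans hs)
  refine fallsOn_of_tendsto (D := fun n => Ici (max 1 (1 / 2 ^ (-(n : ℤ))))) hpos
    (fun _ => nonempty_Ici) X.tendsto_lowerIndex_infty hr fun n s hs => ?_
  have hlog : (n : ℤ) ≤ Int.log 2 s := by
    rw [← Int.zpow_le_iff_le_log one_lt_two (hpos n s hs), Nat.cast_ofNat]
    calc (2 : ℝ) ^ (n : ℤ) = 1 / 2 ^ (-(n : ℤ)) := by rw [zpow_neg, one_div, inv_inv]
      _ ≤ s := (le_max_right _ _).trans hs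
  simp only [mem_Ici]
  omega

end Fundamental

/-! ### Approximate eigenvalues of the doubling operator -/

section Doubling

variable {X : RISpace} [Nontrivial X.carrier] {ev : ℝ}

lemma RISpace.fundamental_div_zpow_pos {r : ℝ} (hr : 0 < r) (k : ℤ) :
    0 < X.fundamental (2 ^ k) / r ^ k :=
  div_pos (X.fundamental_pos (zpow_pos two_pos k)) (zpow_pos hr k)

lemma RISpace.isApproximateEigenvalue_doubling (hev : 0 < ev)
    (h : ∀ r ∈ Ioo 0 ev, ∀ q ∈ Ioi ev, ∀ K : ℝ,
      RisesThenFalls (fun k => X.fundamental (2 ^ k) / r ^ k)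
        (fun k => X.fundamental (2 ^ k) / q ^ k) K) :
    IsApproximateEigenvalue X.doubling ev :=
  isApproximateEigenvalue_of_shift X.doubling_dyadicBlock X.isOneUnconditional_dyadicBlock
    X.dyadicBlock_ne_zero hev (by simpa only [X.norm_dyadicBlock] using h)

lemma RISpace.isApproximateEigenvalue_doubling_of_le_upperIndex_zero
    (hlower : 2 ^ lowerIndex (dilationFn X.fundamental) ≤ ev)
    (hupper : ev ≤ 2 ^ upperIndex (dilationFnZero X.fundamental)) :
    IsApproximateEigenvalue X.doubling ev := by
  refine isApproximateEigenvalue_doubling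
    ((Real.rpow_pos_of_pos two_pos _).trans_le hlower) fun r hr q hq => ?_
  exact (risesOn_Iic_of_lt_upperIndex_zero hr.1 (hr.2.trans_le hupper)).risesThenFalls_of_Iic
    (fundamental_div_zpow_pos hr.1) (fallsOn_univ_of_lowerIndex_lt (hlower.trans_lt hq))

lemma RISpace.isApproximateEigenvalue_doubling_of_lowerIndex_infty_le
    (hlower : 2 ^ lowerIndex (dilationFnInfty X.fundamental) ≤ ev)
    (hupper : ev ≤ 2 ^ upperIndex (dilationFn X.fundamental)) :
    IsApproximateEigenvalue X.doubling ev := by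
  have hev : 0 < ev := (Real.rpow_pos_of_pos two_pos _).trans_le hlower
  refine isApproximateEigenvalue_doubling hev fun r hr q hq => ?_
  exact (risesOn_univ_of_lt_upperIndex hr.1 (hr.2.trans_le hupper)).risesThenFalls_of_Ici
    (fundamental_div_zpow_pos (hev.trans hq))
    (fallsOn_Ici_of_lowerIndex_infty_lt (hlower.trans_lt hq))

end Doubling

theorem mainTheorem8_general (X : RISpace) [Nontrivial X.carrier] :
    ∀ ev ∈ Icc ((2 : ℝ) ^ lowerIndex (dilationFn X.fundamental))
          ((2 : ℝ) ^ upperIndex (dilationFnZero X.fundamental)) ∪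
        Icc ((2 : ℝ) ^ lowerIndex (dilationFnInfty X.fundamental))
          ((2 : ℝ) ^ upperIndex (dilationFn X.fundamental)),
      IsApproximateEigenvalue X.doubling ev := by
  rintro ev (⟨hlower, hupper⟩ | ⟨hlower, hupper⟩)
  · exact RISpace.isApproximateEigenvalue_doubling_of_le_upperIndex_zero hlower hupper
  · exact RISpace.isApproximateEigenvalue_doubling_of_lowerIndex_infty_le hlower hupper

theorem mainTheorem8 (X : RISpace) [Nontrivial X.carrier]
    [TopologicalSpace.SeparableSpace X.carrier] :
    (lowerIndex (dilationFnInfty X.fundamental) ≤ upperIndex (dilationFnZero X.fundamental) →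
      ∀ ev ∈ Icc ((2 : ℝ) ^ lowerIndex (dilationFn X.fundamental))
          ((2 : ℝ) ^ upperIndex (dilationFn X.fundamental)),
        IsApproximateEigenvalue X.doubling ev) ∧
    (lowerIndex (dilationFnInfty X.fundamental) > upperIndex (dilationFnZero X.fundamental) →
      ∀ ev ∈ Icc ((2 : ℝ) ^ lowerIndex (dilationFn X.fundamental))
            ((2 : ℝ) ^ upperIndex (dilationFnZero X.fundamental)) ∪
          Icc ((2 : ℝ) ^ lowerIndex (dilationFnInfty X.fundamental))
            ((2 : ℝ) ^ upperIndex (dilationFn X.fundamental)),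
        IsApproximateEigenvalue X.doubling ev) := by
  exact ⟨fun hle ev hev => mainTheorem8_general X ev (Icc_subset_Icc_union_Icc.trans
    (union_subset_union_right _ (Icc_subset_Icc_left
      (Real.rpow_le_rpow_of_exponent_le one_le_two hle))) hev),
    fun _ => mainTheorem8_general X⟩
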